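/- Let $G=(V,E)$ be a finite simple planar graph, that is, a finite graph without loops and parallel edges that can be drawn in the plane (vertices as distinct points, edges as simple polygonal arcs joining their ends) so that no edge passes through another vertex and two edges meet only in common ends. Let $M$ be the graphic matroid of $G$: its ground set is $E$, and $A\subseteq E$ is independent if and only if $A$ contains no cycle. Then: 1. $M$ is $3$-sparse: $|S|\le 3\,r_M(S)$ for every $S\subseteq E$, where $r_M$ is the rank function of $M$. 2. There is a $3$-competitive non-adaptive mechanism for $M$. Here, a non-adaptive mechanism for $M$ assigns to every family of probability distributions $(D_e)_{e\in E}$ on $[0,\infty)$ the law of a random vector of thresholds $T=(T_e)_{e\in E}\in(\mathbb R\cup\{+\infty\})^E$. Independent values $X_e\sim D_e$ and, independently of them, the vector $T$ are drawn, and all items $e\in E$ are revealed to a gambler one by one in some order; the gambler accepts an item $e$ if and only if $X_e\ge T_e$ and $e$ together with all previously accepted items forms an independent set of $M$. The mechanism is $\alpha$-competitive if, for all distributions $(D_e)_{e\in E}$ and every order of the items (chosen by an adversary who knows the distributions and the mechanism but no realization), the expected total value of the accepted items, with the expectation over both $X$ and $T$, is at least $$\frac1\alpha\,\mathbb E\Big[\max_{S\text{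 independent in }M}\ \sum_{e\in S}X_e\Big].$$ -/

import Mathlib

open MeasureTheory
open scoped NNReal ENNReal

/-! ### Plane drawings and planar graphs -/

/-- `A` is a simple polygonal arc in the plane with ends `x` and `y`: the union of the consecutive
segments `[p i, p (i + 1)]`, `i < n`, of a polygonal path `x = p 0, p 1, …, p n = y` with at least
one segment and no degenerate segment, such that two consecutive segments meet only in their common
corner and any two other segments are disjoint. -/
def IsPolygonalArc (A : Set (ℝ × ℝ)) (x y : ℝ × ℝ) : Prop :=
  ∃ (n : ℕ) (p : ℕ → ℝ × ℝ), 0 < n ∧ p 0 = x ∧ p n = y ∧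
    (∀ i < n, p i ≠ p (i + 1)) ∧
    (∀ i, i + 1 < n →
      segment ℝ (p i) (p (i + 1)) ∩ segment ℝ (p (i + 1)) (p (i + 2)) = {p (i + 1)}) ∧
    (∀ i j, i + 1 < j → j < n →
      Disjoint (segment ℝ (p i) (p (i + 1))) (segment ℝ (p j) (p (j + 1)))) ∧
    A = ⋃ i ∈ Finset.range n, segment ℝ (p i) (p (i + 1))

/-- A drawing of the simple graph `G` in the plane without crossings: distinct vertices are distinct
points, every edge is a simple polygonal arc joining its ends, an edge contains no other
vertex, and two distinct edges meet only in common ends. -/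
structure PlaneDrawing {V : Type*} (G : SimpleGraph V) where
  point : V → ℝ × ℝ
  arc : G.edgeSet → Set (ℝ × ℝ)
  point_injective : Function.Injective point
  arc_isPolygonalArc : ∀ (u v : V) (h : G.Adj u v),
    IsPolygonalArc (arc ⟨s(u, v), h⟩) (point u) (point v)
  mem_of_point_mem_arc : ∀ (e : G.edgeSet) (w : V), point w ∈ arc e → w ∈ (e : Sym2 V)
  eq_point_of_mem_arc : ∀ (e f : G.edgeSet), e ≠ f → ∀ q ∈ arc e ∩ arc f,
    ∃ w : V, w ∈ (e : Sym2 V) ∧ w ∈ (f : Sym2 V) ∧ q = point w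

/-- A graph is planar if it can be drawn in the plane without crossings. -/
def IsPlanar {V : Type*} (G : SimpleGraph V) : Prop := Nonempty (PlaneDrawing G)

/-! ### Graphic matroids -/

namespace GraphicMatroid

variable {V : Type*}

theorem edgeSet_edge_of_ne {a b : V} (h : a ≠ b) :
    (SimpleGraph.edge a b).edgeSet = {s(a, b)} := by
  rw [SimpleGraph.edgeSet_edge, sdiff_eq_left, Set.disjoint_singleton_left]
  simpa using h

/-- If every edge of the forest `J` joins two vertices in the same component of the forest `I`, then
`J` has at most as many edges as `I`. -/
theorem ncard_edgeSet_le [Finite V] (I : SimpleGraph V) (n : ℕ) :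
    ∀ J : SimpleGraph V, (J.edgeSet \ I.edgeSet).ncard = n → J.IsAcyclic →
      (∀ u v, J.Adj u v → I.Reachable u v) → J.edgeSet.ncard ≤ I.edgeSet.ncard := by
  induction n with
  | zero =>
    intro J hn _ _
    rw [Set.ncard_eq_zero (Set.toFinite _), Set.sdiff_eq_empty] at hn
    exact Set.ncard_le_ncard hn (Set.toFinite _)
  | succ n ih =>
    intro J hn hJ hr
    have hne : (J.edgeSet \ I.edgeSet).Nonempty := by
      rw [Set.nonempty_iff_ne_empty]
      intro h0
      simp [h0] at hn
    obtain ⟨e, heJ, heI⟩ := hne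
    induction e with
    | h u v =>
    have hb := SimpleGraph.isAcyclic_iff_forall_isBridge.mp hJ heJ
    rw [SimpleGraph.isBridge_iff] at hb
    set K := J.deleteEdges {s(u, v)} with hK
    have hKe : K.edgeSet = J.edgeSet \ {s(u, v)} := by simp [hK]
    obtain ⟨p⟩ := hr u v heJ
    obtain ⟨d, _, hd1, hd2⟩ := p.exists_boundary_dart {w | K.Reachable u w}
      (SimpleGraph.Reachable.refl u) hb
    obtain ⟨⟨a, b⟩, hab⟩ := d
    simp only [Set.mem_ofPred_eq] at hd1 hd2
    simp only at hab
    have hnr : ¬ K.Reachable a b := fun h => hd2 (hd1.trans h)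
    have hKa : ¬ K.Adj a b := fun h => hnr h.reachable
    have hne' : a ≠ b := hab.ne
    have hedge : (K ⊔ SimpleGraph.edge a b).edgeSet = insert s(a, b) K.edgeSet := by
      rw [SimpleGraph.edgeSet_sup, edgeSet_edge_of_ne hne', Set.union_singleton]
    have hcard : (K ⊔ SimpleGraph.edge a b).edgeSet.ncard = J.edgeSet.ncard := by
      rw [hedge, Set.ncard_insert_of_notMem (by simpa using hKa) (Set.toFinite _), hKe]
      exact Set.ncard_sdiff_singleton_add_one heJ (Set.toFinite _)
    rw [← hcard]
    apply ih
    · have : (K ⊔ SimpleGraph.edge a b).edgeSet \ I.edgeSet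
          = (J.edgeSet \ I.edgeSet) \ {s(u, v)} := by
        rw [hedge, hKe, Set.insert_sdiff_of_mem _ (by simpa using hab), Set.sdiff_sdiff_comm]
      rw [this, Set.ncard_sdiff_singleton_of_mem (Set.mem_sdiff_of_mem heJ heI), hn]
      rfl
    · exact (hJ.anti (SimpleGraph.deleteEdges_le _)).sup_edge_of_not_reachable hnr
    · intro x y hxy
      rw [SimpleGraph.sup_adj] at hxy
      rcases hxy with h | h
      · exact hr x y (SimpleGraph.deleteEdges_le _ h)
      · rw [SimpleGraph.edge_adj] at h
        rcases h with ⟨⟨rfl, rfl⟩ | ⟨rfl, rfl⟩, _⟩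
        · exact hab.reachable
        · exact hab.reachable.symm

variable (G : SimpleGraph V)

/-- The spanning subgraph of `G` whose edges are those in `A`. -/
def spanningSubgraph (A : Set G.edgeSet) : SimpleGraph V :=
  SimpleGraph.fromEdgeSet (Subtype.val '' A)

variable {G}

theorem edgeSet_spanningSubgraph (A : Set G.edgeSet) :
    (spanningSubgraph G A).edgeSet = Subtype.val '' A := by
  rw [spanningSubgraph, SimpleGraph.edgeSet_fromEdgeSet, sdiff_eq_left]
  rw [Set.disjoint_left]
  rintro _ ⟨e, _, rfl⟩
  exact G.not_isDiag_of_mem_edgeSet e.2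

theorem exists_augment [Finite V] (I J : Set G.edgeSet)
    (hI : (spanningSubgraph G I).IsAcyclic) (hJ : (spanningSubgraph G J).IsAcyclic)
    (h : I.ncard < J.ncard) :
    ∃ e ∈ J, e ∉ I ∧ (spanningSubgraph G (insert e I)).IsAcyclic := by
  by_contra! hcon
  have key := ncard_edgeSet_le (spanningSubgraph G I) _ (spanningSubgraph G J) rfl hJ ?_
  · rw [edgeSet_spanningSubgraph, edgeSet_spanningSubgraph,
      Set.ncard_image_of_injective _ Subtype.val_injective,
      Set.ncard_image_of_injective _ Subtype.val_injective] at key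
    omega
  · intro u v huv
    have hm : s(u, v) ∈ (spanningSubgraph G J).edgeSet := huv
    rw [edgeSet_spanningSubgraph] at hm
    obtain ⟨e, heJ, he⟩ := hm
    by_contra hnr
    by_cases heI : e ∈ I
    · refine hnr (SimpleGraph.Adj.reachable ?_)
      rw [← SimpleGraph.mem_edgeSet, edgeSet_spanningSubgraph]
      exact ⟨e, heI, he⟩
    · refine hcon e heJ heI ?_
      have := hI.sup_edge_of_not_reachable hnr
      convert this using 1
      rw [← SimpleGraph.edgeSet_inj, edgeSet_spanningSubgraph, SimpleGraph.edgeSet_sup,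
        edgeSet_edge_of_ne huv.ne, edgeSet_spanningSubgraph, Set.image_insert_eq, he,
        Set.union_singleton]

end GraphicMatroid

/-- The graphic matroid of a finite simple graph `G`: its ground set consists of all edges of `G`,
and a set of edges is independent if and only if it contains no cycle. -/
def graphicMatroid {V : Type*} [Finite V] (G : SimpleGraph V) : Matroid G.edgeSet :=
  (IndepMatroid.ofFinite (E := Set.univ) Set.finite_univ
    (fun A => (GraphicMatroid.spanningSubgraph G A).IsAcyclic)
    (by simp [GraphicMatroid.spanningSubgraph])
    (fun _ _ hJ hIJ => hJ.anti (SimpleGraph.fromEdgeSet_mono (Set.image_mono hIJ)))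
    (fun I J hI hJ h => GraphicMatroid.exists_augment I J hI hJ h)
    (fun _ _ => Set.subset_univ _)).matroid

theorem graphicMatroid_indep_iff {V : Type*} [Finite V] (G : SimpleGraph V) (A : Set G.edgeSet) :
    (graphicMatroid G).Indep A ↔
      (SimpleGraph.fromEdgeSet (Subtype.val '' A : Set (Sym2 V))).IsAcyclic :=
  Iff.rfl

/-- A matroid is `γ`-sparse if `|S| ≤ γ * r(S)` for every (finite) subset `S` of its ground set. -/
def IsSparse {E : Type*} (γ : ℝ) (M : Matroid E) : Prop :=
  ∀ S : Finset E, (S : Set E) ⊆ M.E → (S.card : ℝ) ≤ γ * ((M.eRk (S : Set E)).toNat : ℝ)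

/-! ### The prophet, the gambler and non-adaptive mechanisms

The items are the elements of a finite type `E`, and `x i` is the realized value of the item `i`. -/

open Classical in
/-- The value obtained by the prophet: the maximum weight of an independent set of items. -/
noncomputable def prophetValue {E : Type*} [Fintype E] (M : Matroid E) (x : E → ℝ≥0) : ℝ≥0 :=
  (Finset.univ.filter fun S : Finset E => M.Indep (S : Set E)).sup fun S => ∑ i ∈ S, x i

open Classical in
/-- The set of items accepted by the gambler, who has already accepted the items in the second
argument and to whom the items of the list are then revealed in this order: an item is accepted if
and only if its value is at least its threshold and it forms an independent set together with all
items accepted before. -/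
noncomputable def acceptedFrom {E : Type*} (M : Matroid E) (T : E → WithTop ℝ) (x : E → ℝ≥0) :
    List E → Finset E → Finset E
  | [], S => S
  | i :: l, S =>
    if T i ≤ ((x i : ℝ) : WithTop ℝ) ∧ M.Indep (insert i (S : Set E)) then
      acceptedFrom M T x l (insert i S)
    else acceptedFrom M T x l S

/-- The total value obtained by the gambler with thresholds `T` when the items, with values `x`, are
revealed in the order given by the list `order`. -/
noncomputable def gamblerValue {E : Type*} (M : Matroid E) (T : E → WithTop ℝ)
    (order : List E) (x : E → ℝ≥0) : ℝ≥0 :=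
  ∑ i ∈ acceptedFrom M T x order ∅, x i

/-- The joint law of independent item values with the given distributions on `[0, ∞)`. -/
noncomputable def valueLaw {E : Type*} [Fintype E] (D : E → ProbabilityMeasure ℝ≥0) :
    Measure (E → ℝ≥0) :=
  Measure.pi fun i => (D i : Measure ℝ≥0)

/-- A (possibly randomized) non-adaptive mechanism for the items `E`: knowing the distributions of
the item values, it determines the law of the vector of thresholds in `ℝ ∪ {+∞}`. The
thresholds are drawn from this law independently of the item values. -/
structure NonAdaptiveMechanism (E : Type*) [Fintype E] where
  thresholdLaw : (E → ProbabilityMeasure ℝ≥0) → ProbabilityMeasure (E → WithTop ℝ)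

/-- The expected value obtained by the prophet. -/
noncomputable def expectedProphet {E : Type*} [Fintype E] (M : Matroid E)
    (D : E → ProbabilityMeasure ℝ≥0) : ℝ≥0∞ :=
  ∫⁻ x, (prophetValue M x : ℝ≥0∞) ∂(valueLaw D)

/-- The expected value obtained by the gambler via the mechanism `A` when the items arrive in the
order given by the list `order`; the expectation is over the thresholds and the item values. -/
noncomputable def expectedGambler {E : Type*} [Fintype E] (M : Matroid E)
    (A : NonAdaptiveMechanism E) (D : E → ProbabilityMeasure ℝ≥0) (order : List E) : ℝ≥0∞ :=
  ∫⁻ T, ∫⁻ x, (gamblerValue M T order x : ℝ≥0∞) ∂(valueLaw D)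
    ∂(A.thresholdLaw D : Measure (E → WithTop ℝ))

/-- The mechanism `A` is `α`-competitive on the matroid `M`: for all distributions of the item
values and every order in which the adversary (who knows the distributions and the mechanism, but no
realization) may present all the items, the gambler's expected value is at least `1 / α` times
the prophet's expected value. -/
def NonAdaptiveMechanism.IsCompetitive {E : Type*} [Fintype E] (A : NonAdaptiveMechanism E)
    (α : ℝ) (M : Matroid E) : Prop :=
  ∀ (D : E → ProbabilityMeasure ℝ≥0) (order : List E), order.Nodup → (∀ i, i ∈ order) →
    ENNReal.ofReal (1 / α) * expectedProphet M D ≤ expectedGambler M A D order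

/-! Sparsity comes from a bound on cycle spaces, obtained without Euler's formula or any topology of
faces. Let C be the cycle space, over the field with two elements, of the subgraph with edge set S.
Give each e ∈ S the functional Z ↦ Z e on C as its weight w e, and every other edge the weight 0; at
each vertex these weights sum to zero. Label a point of the plane by the total weight of the drawing
vertically above it. The label stays constant along a side of an edge and jumps by w e across e
(`PlaneDrawing.exists_potential`). For each label m, the edges with m on exactly one side form an
element c m of C, a substitute for a face boundary. Every edge lies in at most two of the c m, a
nonzero c m has at least three edges because G is simple, and Z = ∑ m(Z) c m, so the c m span C.
Hence 3 dim C ≤ 2|S|. As the boundary map has rank at most r(S), rank-nullity gives |S| ≤ r(S) +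
2|S|/3.

For the mechanism, let I be a greedy basis for the expected values. Among the items of largest
weight, I always contains a basis, hence at least a third of them; so I carries a third of the sum
of all expected values (`exists_indep_weight_aux`). With threshold 0 on I and +∞ elsewhere the
gambler obtains exactly I in every order, while the prophet never obtains more than the sum of all
values. -/

/-! ### Arrangements of segments -/

/-- The height over `x` of the line through `p` and `q`. -/
noncomputable def lineHeight (p q : ℝ × ℝ) (x : ℝ) : ℝ :=
  p.2 + (x - p.1) / (q.1 - p.1) * (q.2 - p.2)

theorem lineHeight_left (p q : ℝ × ℝ) : lineHeight p q p.1 = p.2 := by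
  simp [lineHeight]

theorem lineHeight_right {p q : ℝ × ℝ} (h : p.1 < q.1) : lineHeight p q q.1 = q.2 := by
  have : q.1 - p.1 ≠ 0 := by linarith
  simp [lineHeight, div_self this]

theorem continuous_lineHeight (p q : ℝ × ℝ) : Continuous (lineHeight p q) := by
  unfold lineHeight
  fun_prop

theorem lineHeight_mem_segment {p q : ℝ × ℝ} (h : p.1 < q.1) {x : ℝ}
    (hx : x ∈ Set.Icc p.1 q.1) : (x, lineHeight p q x) ∈ segment ℝ p q := by
  rw [segment_eq_image_lineMap]
  have h0 : 0 < q.1 - p.1 := by linarith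
  refine ⟨(x - p.1) / (q.1 - p.1), ⟨div_nonneg (by linarith [hx.1]) h0.le, ?_⟩, ?_⟩
  · rw [div_le_one h0]
    linarith [hx.2]
  · ext
    · simp [AffineMap.lineMap_apply]
      field_simp
      ring
    · simp [AffineMap.lineMap_apply, lineHeight]
      ring

theorem lt_iff_lt_of_forall_ne {f g : ℝ → ℝ} (hf : Continuous f) (hg : Continuous g) {s : Set ℝ}
    (hs : IsPreconnected s) (hne : ∀ z ∈ s, f z ≠ g z) {x y : ℝ} (hx : x ∈ s) (hy : y ∈ s) :
    f x < g x ↔ f y < g y := by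
  have key : ∀ x ∈ s, ∀ y ∈ s, f x < g x → f y < g y := by
    intro x hx y hy h
    by_contra h'
    obtain ⟨z, hz, hzz⟩ := hs.intermediate_value₂ hx hy hf.continuousOn hg.continuousOn h.le
      (not_lt.mp h')
    exact hne z hz hzz
  exact ⟨key x hx y hy, key y hy x hx⟩

/-- A family of nonvertical segments in the plane, given by their left and right ends, any two of
which meet only in common ends, and whose ends have pairwise distinct abscissae. -/
structure SegmentArrangement (ι : Type*) where
  left : ι → ℝ × ℝ
  right : ι → ℝ × ℝ
  left_lt_right : ∀ i, (left i).1 < (right i).1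
  eq_end_of_mem : ∀ i j, i ≠ j → ∀ p ∈ segment ℝ (left i) (right i),
    p ∈ segment ℝ (left j) (right j) → p = left i ∨ p = right i
  end_injective : ∀ p ∈ Set.range left ∪ Set.range right,
    ∀ q ∈ Set.range left ∪ Set.range right, p.1 = q.1 → p = q

/-- Telescoping over the members of a finite family listed by decreasing height. -/
theorem sum_telescope {ι M : Type*} [AddCommGroup M] (h : ι → ℝ) (w : ι → M) (g : M → ZMod 2)
    (a : M) (R : Finset ι) (hR : Set.InjOn h R) :
    ∑ i ∈ R, (g (a + ∑ j ∈ R with h i < h j, w j) + g (a + ∑ j ∈ R with h i < h j, w j + w i))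
      = g a + g (a + ∑ i ∈ R, w i) := by
  classical
  -- The lowest member comes last: it changes no earlier prefix sum, and its own prefix is all of
  -- the rest.
  induction R using Finset.induction_on_min_value h with
  | empty => simp [CharTwo.add_self_eq_zero]
  | insert i R hi hmin ih =>
    have hlt : ∀ j ∈ R, h i < h j := fun j hj => lt_of_le_of_ne (hmin j hj) fun he =>
      hi (hR (by simp) (by simp [hj]) he ▸ hj)
    have h1 : (insert i R).filter (fun j => h i < h j) = R := by
      rw [Finset.filter_insert, if_neg (lt_irrefl _), Finset.filter_true_of_mem hlt]
    have h2 : ∀ k ∈ R, (insert i R).filter (fun j => h k < h j) = R.filter (fun j => h k < h j) :=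
      fun k hk => by rw [Finset.filter_insert, if_neg (hmin k hk).not_gt]
    have h3 : ∑ k ∈ R, (g (a + ∑ j ∈ insert i R with h k < h j, w j) +
        g (a + ∑ j ∈ insert i R with h k < h j, w j + w k)) =
        ∑ k ∈ R, (g (a + ∑ j ∈ R with h k < h j, w j) +
          g (a + ∑ j ∈ R with h k < h j, w j + w k)) :=
      Finset.sum_congr rfl fun k hk => by rw [h2 k hk]
    rw [Finset.sum_insert hi, h1, h3, ih (hR.mono (by simp)), Finset.sum_insert hi, add_comm (w i), ← add_assoc a]
    generalize g a = x
    generalize g _ = y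
    generalize g _ = z
    linear_combination CharTwo.add_self_eq_zero y

/-! ### Potentials from the weight lying overhead -/

namespace SegmentArrangement

variable {ι M : Type*} (A : SegmentArrangement ι)

noncomputable def height (i : ι) : ℝ → ℝ := lineHeight (A.left i) (A.right i)

theorem height_left (i : ι) : A.height i (A.left i).1 = (A.left i).2 := lineHeight_left _ _

theorem height_right (i : ι) : A.height i (A.right i).1 = (A.right i).2 :=
  lineHeight_right (A.left_lt_right i)

theorem height_ne {i j : ι} (hij : i ≠ j) {x : ℝ} (hi : x ∈ Set.Ioo (A.left i).1 (A.right i).1)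
    (hj : x ∈ Set.Icc (A.left j).1 (A.right j).1) : A.height i x ≠ A.height j x := by
  intro h
  have h1 := lineHeight_mem_segment (A.left_lt_right i) (Set.Ioo_subset_Icc_self hi)
  have h2 := lineHeight_mem_segment (A.left_lt_right j) hj
  change (x, A.height i x) ∈ _ at h1
  change (x, A.height j x) ∈ _ at h2
  rw [← h] at h2
  rcases A.eq_end_of_mem i j hij _ h1 h2 with h3 | h3
  · exact hi.1.ne' (congrArg Prod.fst h3)
  · exact hi.2.ne (congrArg Prod.fst h3)

theorem height_lt_iff {i j : ι} (s : Set ℝ) (hs : IsPreconnected s)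
    (hne : ∀ z ∈ s, A.height i z ≠ A.height j z) {x y : ℝ} (hx : x ∈ s) (hy : y ∈ s) :
    A.height i x < A.height j x ↔ A.height i y < A.height j y :=
  lt_iff_lt_of_forall_ne (continuous_lineHeight _ _) (continuous_lineHeight _ _) hs hne hx hy

variable [Fintype ι]

open Classical in
/-- The segments over the point of the segment `i` with abscissa `x`. -/
noncomputable def above (i : ι) (x : ℝ) : Finset ι :=
  Finset.univ.filter fun t =>
    (A.left t).1 ≤ x ∧ x < (A.right t).1 ∧ A.height i x < A.height t x

theorem mem_above {i t : ι} {x : ℝ} : t ∈ A.above i x ↔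
    (A.left t).1 ≤ x ∧ x < (A.right t).1 ∧ A.height i x < A.height t x := by
  simp [above]

variable [AddCommGroup M]

-- As the abscissa sweeps along the segment `i`, the set overhead changes only at ends lying above
-- `i`. By `hw` the weights meeting at such an end cancel; `hM` makes signs irrelevant. The
-- half-open range in `above` counts each segment consistently at its ends.
open Classical in
theorem sum_above_eq_of_lt (hM : ∀ m : M, m + m = 0) (w : ι → M)
    (hw : ∀ q, ∑ i, ((if A.left i = q then w i else 0) + if A.right i = q then w i else 0) = 0)
    (i : ι) {x y : ℝ} (hx : (A.left i).1 < x) (hxy : x < y) (hy : y < (A.right i).1) :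
    ∑ t ∈ A.above i x, w t = ∑ t ∈ A.above i y, w t := by
  -- The ends above `i` that the sweep from `x` to `y` passes.
  let S : Finset (ℝ × ℝ) := (Finset.univ.image A.left ∪ Finset.univ.image A.right).filter
    fun q => x < q.1 ∧ q.1 ≤ y ∧ A.height i q.1 < q.2
  have hS : ∑ t, ((if A.left t ∈ S then w t else 0) + if A.right t ∈ S then w t else 0) = 0 := by
    refine Eq.trans ?_ (Finset.sum_eq_zero fun q (_ : q ∈ S) => hw q)
    rw [Finset.sum_comm]
    refine Finset.sum_congr rfl fun t _ => ?_
    rw [Finset.sum_add_distrib, Finset.sum_ite_eq, Finset.sum_ite_eq]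
  have hl : ∀ t, A.left t ∈ S ↔ x < (A.left t).1 ∧ (A.left t).1 ≤ y ∧
      A.height i (A.left t).1 < A.height t (A.left t).1 := fun t => by simp [S, A.height_left]
  have hr : ∀ t, A.right t ∈ S ↔ x < (A.right t).1 ∧ (A.right t).1 ≤ y ∧
      A.height i (A.right t).1 < A.height t (A.right t).1 := fun t => by simp [S, A.height_right]
  -- Segments do not cross, so over their common abscissae `t` is always above `i` or never; `key`
  -- then only compares intervals.
  have hB : ∀ t, ∃ B : Prop, ∀ z ∈ Set.Icc x y ∩ Set.Icc (A.left t).1 (A.right t).1,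
      (A.height i z < A.height t z ↔ B) := by
    intro t
    by_cases hti : i = t
    · subst hti
      exact ⟨False, by simp⟩
    rcases (Set.Icc x y ∩ Set.Icc (A.left t).1 (A.right t).1).eq_empty_or_nonempty with h | ⟨z, hz⟩
    · exact ⟨False, by simp [h]⟩
    · refine ⟨_, fun z' hz' => A.height_lt_iff _ ?_ (fun u hu => ?_) hz' hz⟩
      · rw [Set.Icc_inter_Icc]
        exact isPreconnected_Icc
      · exact A.height_ne hti ⟨hx.trans_le hu.1.1, hu.1.2.trans_lt hy⟩ hu.2
  have key : ∀ t, (if t ∈ A.above i x then w t else 0) = (if t ∈ A.above i y then w t else 0) +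
      ((if A.left t ∈ S then w t else 0) + if A.right t ∈ S then w t else 0) := by
    intro t
    obtain ⟨B, hB⟩ := hB t
    have hlt := A.left_lt_right t
    have e1 : t ∈ A.above i x ↔ (A.left t).1 ≤ x ∧ x < (A.right t).1 ∧ B := by
      rw [mem_above]
      refine and_congr_right fun h1 => and_congr_right fun h2 => hB x ?_
      exact ⟨⟨le_rfl, hxy.le⟩, h1, h2.le⟩
    have e2 : t ∈ A.above i y ↔ (A.left t).1 ≤ y ∧ y < (A.right t).1 ∧ B := by
      rw [mem_above]
      refine and_congr_right fun h1 => and_congr_right fun h2 => hB y ?_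
      exact ⟨⟨hxy.le, le_rfl⟩, h1, h2.le⟩
    have e3 : A.left t ∈ S ↔ x < (A.left t).1 ∧ (A.left t).1 ≤ y ∧ B := by
      rw [hl]
      refine and_congr_right fun h1 => and_congr_right fun h2 => hB _ ?_
      exact ⟨⟨h1.le, h2⟩, le_rfl, hlt.le⟩
    have e4 : A.right t ∈ S ↔ x < (A.right t).1 ∧ (A.right t).1 ≤ y ∧ B := by
      rw [hr]
      refine and_congr_right fun h1 => and_congr_right fun h2 => hB _ ?_
      exact ⟨⟨h1.le, h2⟩, hlt.le, le_rfl⟩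
    simp only [e1, e2, e3, e4]
    generalize (A.left t).1 = a at *
    generalize (A.right t).1 = b at *
    have := hM (w t)
    by_cases hb : B
    · simp only [hb, and_true, ← not_le (a := a), ← not_lt (b := b)]
      by_cases h1 : a ≤ x <;> by_cases h2 : a ≤ y <;> by_cases h3 : x < b <;>
        by_cases h4 : y < b <;>
        first
          | (exfalso; linarith)
          | simp [h1, h2, h3, h4, this]
    · simp [hb]
  have := Finset.sum_congr (rfl : (Finset.univ : Finset ι) = _) fun t _ => key t
  rw [Finset.sum_add_distrib, hS, add_zero, Finset.sum_ite_mem, Finset.sum_ite_mem,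
    Finset.univ_inter, Finset.univ_inter] at this
  exact this

/-- The sum of the weights of the segments over the midpoint of the segment `i`. -/
noncomputable def potential (w : ι → M) (i : ι) : M :=
  ∑ t ∈ A.above i (((A.left i).1 + (A.right i).1) / 2), w t

open Classical in
theorem sum_above_eq_potential (hM : ∀ m : M, m + m = 0) (w : ι → M)
    (hw : ∀ q, ∑ i, ((if A.left i = q then w i else 0) + if A.right i = q then w i else 0) = 0)
    (i : ι) {x : ℝ} (hx : x ∈ Set.Ioo (A.left i).1 (A.right i).1) :
    ∑ t ∈ A.above i x, w t = A.potential w i := by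
  have := A.left_lt_right i
  rcases lt_trichotomy x (((A.left i).1 + (A.right i).1) / 2) with h | h | h
  · exact A.sum_above_eq_of_lt hM w hw i hx.1 h (by linarith)
  · rw [h]; rfl
  · exact (A.sum_above_eq_of_lt hM w hw i (by linarith) h hx.2).symm

open Classical in
/-- The total weight of the segments passing over the point `q`. -/
noncomputable def passing (w : ι → M) (q : ℝ × ℝ) : M :=
  ∑ t with (A.left t).1 < q.1 ∧ q.1 < (A.right t).1 ∧ q.2 < A.height t q.1, w t

-- Just to the right of `q`, the segments starting at `q` bound sectors. From top to bottom their
-- labels start at `passing w q` and grow by one weight at a time, so the jumps of `g` telescope.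
open Classical in
theorem sum_potential_left (hM : ∀ m : M, m + m = 0) (w : ι → M)
    (hw : ∀ q, ∑ i, ((if A.left i = q then w i else 0) + if A.right i = q then w i else 0) = 0)
    (g : M → ZMod 2) {q : ℝ × ℝ} (hq : q ∈ Set.range A.left ∪ Set.range A.right) :
    ∑ i with A.left i = q, (g (A.potential w i) + g (A.potential w i + w i)) =
      g (A.passing w q) + g (A.passing w q + ∑ i with A.left i = q, w i) := by
  -- So close to `q` that no end has its abscissa in `(q.1, x]`.
  obtain ⟨x, hx, hqx : q.1 < x⟩ : ∃ x, (∀ i, (q.1 < (A.left i).1 → x < (A.left i).1) ∧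
      (q.1 < (A.right i).1 → x < (A.right i).1)) ∧ q.1 < x := by
    have h1 : ∀ᶠ x in nhdsWithin q.1 (Set.Ioi q.1), ∀ i, (q.1 < (A.left i).1 → x < (A.left i).1) ∧
        (q.1 < (A.right i).1 → x < (A.right i).1) := by
      refine Filter.eventually_all.2 fun i => Filter.Eventually.and ?_ ?_ <;>
      · rw [Filter.eventually_imp_distrib_left]
        exact fun h => (eventually_lt_nhds h).filter_mono nhdsWithin_le_nhds
    exact (h1.and self_mem_nhdsWithin).exists
  have hxR : ∀ i, A.left i = q → x ∈ Set.Ioo (A.left i).1 (A.right i).1 := by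
    rintro i rfl
    exact ⟨hqx, (hx i).2 (A.left_lt_right i)⟩
  rw [← sum_telescope (fun i => A.height i x)]
  · refine Finset.sum_congr rfl fun i hi => ?_
    rw [Finset.mem_filter_univ] at hi
    -- What lies above `i` at `x` either passes over `q` or starts at `q` and is higher than `i`; an
    -- end with the abscissa of `q` is `q` itself.
    have : A.potential w i = A.passing w q +
        ∑ j ∈ Finset.univ.filter (fun j => A.left j = q) with A.height i x < A.height j x,
          w j := by
      rw [← A.sum_above_eq_potential hM w hw i (hxR i hi), passing, ← Finset.sum_union]
      · refine Finset.sum_congr ?_ fun _ _ => rfl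
        ext t
        simp only [mem_above, Finset.mem_union, Finset.mem_filter, Finset.mem_univ, true_and]
        have side : (A.left t).1 < q.1 → x < (A.right t).1 →
            (A.height i x < A.height t x ↔ q.2 < A.height t q.1) := by
          intro h1 h2
          have hti : t ≠ i := by
            rintro rfl
            rw [hi] at h1
            exact lt_irrefl _ h1
          have := A.height_lt_iff (i := i) (j := t) (Set.Icc q.1 x) isPreconnected_Icc
            (fun z hz => (A.height_ne hti ⟨h1.trans_le hz.1, hz.2.trans_lt h2⟩
              ⟨by rw [hi]; exact hz.1, hz.2.trans (hxR i hi).2.le⟩).symm)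
            (Set.right_mem_Icc.2 hqx.le) (Set.left_mem_Icc.2 hqx.le)
          have hh := A.height_left i
          rw [hi] at hh
          rwa [hh] at this
        constructor
        · rintro ⟨h1, h2, h3⟩
          have h4 : (A.left t).1 ≤ q.1 := not_lt.1 fun h => ((hx t).1 h).not_ge h1
          rcases h4.lt_or_eq with h4 | h4
          · exact Or.inl ⟨h4, hqx.trans h2, (side h4 h2).1 h3⟩
          · exact Or.inr ⟨A.end_injective _ (Or.inl ⟨t, rfl⟩) _ hq h4, h3⟩
        · rintro (⟨h1, h2, h3⟩ | ⟨h1, h3⟩)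
          · exact ⟨(h1.trans hqx).le, (hx t).2 h2, (side h1 ((hx t).2 h2)).2 h3⟩
          · exact ⟨(hxR t h1).1.le, (hxR t h1).2, h3⟩
      · rw [Finset.disjoint_left]
        intro t h1 h2
        simp only [Finset.mem_filter, Finset.mem_univ, true_and] at h1 h2
        rw [h2.1] at h1
        exact lt_irrefl _ h1.1
    rw [this]
  · intro i hi j hj hij
    by_contra hne
    simp only [Finset.coe_filter, Finset.mem_univ, true_and, Set.mem_ofPred_eq] at hi hj
    exact A.height_ne hne (hxR i hi) (Set.Ioo_subset_Icc_self (hxR j hj)) hij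

-- The mirror image of `sum_potential_left`, for the sectors just to the left of `q`.
open Classical in
theorem sum_potential_right (hM : ∀ m : M, m + m = 0) (w : ι → M)
    (hw : ∀ q, ∑ i, ((if A.left i = q then w i else 0) + if A.right i = q then w i else 0) = 0)
    (g : M → ZMod 2) {q : ℝ × ℝ} (hq : q ∈ Set.range A.left ∪ Set.range A.right) :
    ∑ i with A.right i = q, (g (A.potential w i) + g (A.potential w i + w i)) =
      g (A.passing w q) + g (A.passing w q + ∑ i with A.right i = q, w i) := by
  obtain ⟨x, hx, hqx : x < q.1⟩ : ∃ x, (∀ i, ((A.left i).1 < q.1 → (A.left i).1 < x) ∧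
      ((A.right i).1 < q.1 → (A.right i).1 < x)) ∧ x < q.1 := by
    have h1 : ∀ᶠ x in nhdsWithin q.1 (Set.Iio q.1), ∀ i, ((A.left i).1 < q.1 → (A.left i).1 < x) ∧
        ((A.right i).1 < q.1 → (A.right i).1 < x) := by
      refine Filter.eventually_all.2 fun i => Filter.Eventually.and ?_ ?_ <;>
      · rw [Filter.eventually_imp_distrib_left]
        exact fun h => (eventually_gt_nhds h).filter_mono nhdsWithin_le_nhds
    exact (h1.and self_mem_nhdsWithin).exists
  have hxR : ∀ i, A.right i = q → x ∈ Set.Ioo (A.left i).1 (A.right i).1 := by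
    rintro i rfl
    exact ⟨(hx i).1 (A.left_lt_right i), hqx⟩
  rw [← sum_telescope (fun i => A.height i x)]
  · refine Finset.sum_congr rfl fun i hi => ?_
    rw [Finset.mem_filter_univ] at hi
    have : A.potential w i = A.passing w q +
        ∑ j ∈ Finset.univ.filter (fun j => A.right j = q) with A.height i x < A.height j x,
          w j := by
      rw [← A.sum_above_eq_potential hM w hw i (hxR i hi), passing, ← Finset.sum_union]
      · refine Finset.sum_congr ?_ fun _ _ => rfl
        ext t
        simp only [mem_above, Finset.mem_union, Finset.mem_filter, Finset.mem_univ, true_and]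
        have side : (A.left t).1 < x → q.1 < (A.right t).1 →
            (A.height i x < A.height t x ↔ q.2 < A.height t q.1) := by
          intro h1 h2
          have hti : t ≠ i := by
            rintro rfl
            rw [hi] at h2
            exact lt_irrefl _ h2
          have := A.height_lt_iff (i := i) (j := t) (Set.Icc x q.1) isPreconnected_Icc
            (fun z hz => (A.height_ne hti ⟨h1.trans_le hz.1, hz.2.trans_lt h2⟩
              ⟨(hxR i hi).1.le.trans hz.1, by rw [hi]; exact hz.2⟩).symm)
            (Set.left_mem_Icc.2 hqx.le) (Set.right_mem_Icc.2 hqx.le)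
          have hh := A.height_right i
          rw [hi] at hh
          rwa [hh] at this
        constructor
        · rintro ⟨h1, h2, h3⟩
          have h4 : q.1 ≤ (A.right t).1 := not_lt.1 fun h => ((hx t).2 h).not_gt h2
          rcases h4.lt_or_eq with h4 | h4
          · have h5 := (hx t).1 (h1.trans_lt hqx)
            exact Or.inl ⟨h1.trans_lt hqx, h4, (side h5 h4).1 h3⟩
          · exact Or.inr ⟨A.end_injective _ (Or.inr ⟨t, rfl⟩) _ hq h4.symm, h3⟩
        · rintro (⟨h1, h2, h3⟩ | ⟨h1, h3⟩)
          · exact ⟨((hx t).1 h1).le, hqx.trans h2, (side ((hx t).1 h1) h2).2 h3⟩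
          · exact ⟨(hxR t h1).1.le, (hxR t h1).2, h3⟩
      · rw [Finset.disjoint_left]
        intro t h1 h2
        simp only [Finset.mem_filter, Finset.mem_univ, true_and] at h1 h2
        rw [h2.1] at h1
        exact lt_irrefl _ h1.2.1
    rw [this]
  · intro i hi j hj hij
    by_contra hne
    simp only [Finset.coe_filter, Finset.mem_univ, true_and, Set.mem_ofPred_eq] at hi hj
    exact A.height_ne hne (hxR i hi) (Set.Ioo_subset_Icc_self (hxR j hj)) hij

open Classical in
/-- If the weights sum up to zero around every point, then so do the jumps of any function of the
potential. -/
theorem sum_jump_eq_zero (hM : ∀ m : M, m + m = 0) (w : ι → M)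
    (hw : ∀ q, ∑ i, ((if A.left i = q then w i else 0) + if A.right i = q then w i else 0) = 0)
    (g : M → ZMod 2) (q : ℝ × ℝ) :
    ∑ i, ((if A.left i = q then g (A.potential w i) + g (A.potential w i + w i) else 0) +
      if A.right i = q then g (A.potential w i) + g (A.potential w i + w i) else 0) = 0 := by
  by_cases hq : q ∈ Set.range A.left ∪ Set.range A.right
  · have h := hw q
    rw [Finset.sum_add_distrib, ← Finset.sum_filter, ← Finset.sum_filter] at h ⊢
    -- Both half-turns around `q` lead from the label above `q` to the same label below it.
    have h' : ∑ i with A.left i = q, w i = ∑ i with A.right i = q, w i := by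
      rw [eq_neg_of_add_eq_zero_left h, neg_eq_of_add_eq_zero_left (hM _)]
    rw [A.sum_potential_left hM w hw g hq, A.sum_potential_right hM w hw g hq, h']
    exact CharTwo.add_self_eq_zero _
  · refine Finset.sum_eq_zero fun i _ => ?_
    rw [if_neg, if_neg, add_zero]
    · exact fun h => hq (Or.inr ⟨i, h⟩)
    · exact fun h => hq (Or.inl ⟨i, h⟩)

end SegmentArrangement

/-- The shear of the plane in the horizontal direction with parameter `c`. -/
noncomputable def shear (c : ℝ) : ℝ × ℝ →ₗ[ℝ] ℝ × ℝ :=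
  (LinearMap.fst ℝ ℝ ℝ + c • LinearMap.snd ℝ ℝ ℝ).prod (LinearMap.snd ℝ ℝ ℝ)

theorem shear_apply (c : ℝ) (p : ℝ × ℝ) : shear c p = (p.1 + c * p.2, p.2) := rfl

theorem shear_bijective (c : ℝ) : Function.Bijective (shear c) := by
  refine ⟨fun p q h => ?_, fun p => ⟨(p.1 - c * p.2, p.2), by simp [shear_apply]⟩⟩
  simp only [shear_apply, Prod.mk.injEq] at h
  obtain ⟨h1, h2⟩ := h
  rw [h2] at h1
  exact Prod.ext (by linarith) h2

/-- Some shear makes the abscissae of finitely many points pairwise distinct. -/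
theorem exists_shear_fst_injOn {K : Set (ℝ × ℝ)} (hK : K.Finite) :
    ∃ c, Set.InjOn (fun p => (shear c p).1) K := by
  -- The parameters that align two points of different ordinates. For equal ordinates the division
  -- by zero merely excludes 0 as well.
  have hfin : ((K ×ˢ K).image fun pq => (pq.2.1 - pq.1.1) / (pq.1.2 - pq.2.2)).Finite :=
    (hK.prod hK).image _
  obtain ⟨c, hc⟩ := hfin.exists_notMem
  refine ⟨c, fun p hp q hq h => ?_⟩
  simp only [shear_apply] at h
  by_cases h2 : p.2 = q.2
  · exact Prod.ext (by rw [h2] at h; linarith) h2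
  · refine absurd ⟨(p, q), ⟨hp, hq⟩, ?_⟩ hc
    have : p.2 - q.2 ≠ 0 := sub_ne_zero.2 h2
    simp only
    rw [div_eq_iff this]
    linarith

open Classical in
/-- For finitely many segments, any two of which meet only in common ends, and weights that
sum up to zero around every point, there is a potential (assigning a value to one side of each
segment, the value at the other side differing by the weight) such that the jumps of any
function of the potential sum up to zero around every point. -/
theorem exists_potential_of_segments {ι M : Type*} [Fintype ι] [AddCommGroup M] (P Q : ι → ℝ × ℝ)
    (hPQ : ∀ i, P i ≠ Q i)
    (hcross : ∀ i j, i ≠ j → ∀ p ∈ segment ℝ (P i) (Q i), p ∈ segment ℝ (P j) (Q j) →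
      p = P i ∨ p = Q i)
    (hM : ∀ m : M, m + m = 0) (w : ι → M)
    (hw : ∀ q, ∑ i, ((if P i = q then w i else 0) + if Q i = q then w i else 0) = 0) :
    ∃ U : ι → M, ∀ (g : M → ZMod 2) (q : ℝ × ℝ),
      ∑ i, ((if P i = q then g (U i) + g (U i + w i) else 0) +
        if Q i = q then g (U i) + g (U i + w i) else 0) = 0 := by
  obtain ⟨c, hc⟩ := exists_shear_fst_injOn ((Set.finite_range P).union (Set.finite_range Q))
  have hinj := (shear_bijective c).1
  have hx : ∀ {p q}, p ∈ Set.range P ∪ Set.range Q → q ∈ Set.range P ∪ Set.range Q →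
      (shear c p).1 = (shear c q).1 → p = q := fun hp hq h => hc hp hq h
  -- After the shear no segment is vertical, so each can be directed from left to right.
  have hdir : ∀ i, ∃ a b, (shear c a).1 < (shear c b).1 ∧
      (a = P i ∧ b = Q i ∨ a = Q i ∧ b = P i) := by
    intro i
    rcases lt_trichotomy (shear c (P i)).1 (shear c (Q i)).1 with h | h | h
    · exact ⟨_, _, h, Or.inl ⟨rfl, rfl⟩⟩
    · exact absurd (hx (Or.inl ⟨i, rfl⟩) (Or.inr ⟨i, rfl⟩) h) (hPQ i)
    · exact ⟨_, _, h, Or.inr ⟨rfl, rfl⟩⟩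
  choose a b hab hdir using hdir
  have hseg : ∀ i, segment ℝ (shear c (a i)) (shear c (b i)) =
      shear c '' segment ℝ (P i) (Q i) := by
    intro i
    have := image_segment ℝ (shear c).toAffineMap (P i) (Q i)
    simp only [LinearMap.coe_toAffineMap] at this
    rw [this]
    rcases hdir i with ⟨h1, h2⟩ | ⟨h1, h2⟩
    · rw [h1, h2]
    · rw [h1, h2, segment_symm]
  have hmem : ∀ p ∈ (Set.range fun i => shear c (a i)) ∪ Set.range fun i => shear c (b i),
      ∃ p' ∈ Set.range P ∪ Set.range Q, shear c p' = p := by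
    rintro _ (⟨i, rfl⟩ | ⟨i, rfl⟩) <;> refine ⟨_, ?_, rfl⟩ <;>
      rcases hdir i with ⟨h1, h2⟩ | ⟨h1, h2⟩ <;> simp only [h1, h2]
    exacts [Or.inl ⟨i, rfl⟩, Or.inr ⟨i, rfl⟩, Or.inr ⟨i, rfl⟩, Or.inl ⟨i, rfl⟩]
  obtain ⟨A, hA⟩ : ∃ A : SegmentArrangement ι,
      ∀ i, A.left i = shear c (a i) ∧ A.right i = shear c (b i) := by
    refine ⟨⟨fun i => shear c (a i), fun i => shear c (b i), hab, ?_, ?_⟩, fun i => ⟨rfl, rfl⟩⟩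
    · intro i j hij p hpi hpj
      rw [hseg] at hpi hpj
      obtain ⟨p, hp, rfl⟩ := hpi
      obtain ⟨p', hp', h⟩ := hpj
      rw [hinj h] at hp'
      rw [hinj.eq_iff, hinj.eq_iff]
      rcases hdir i with ⟨h1, h2⟩ | ⟨h1, h2⟩
      · rw [h1, h2]
        exact hcross i j hij p hp hp'
      · rw [h1, h2]
        exact (hcross i j hij p hp hp').symm
    · intro p hp q hq hpq
      obtain ⟨p', hp', rfl⟩ := hmem p hp
      obtain ⟨q', hq', rfl⟩ := hmem q hq
      exact congrArg _ (hx hp' hq' hpq)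
  have hw' : ∀ q, ∑ i, ((if A.left i = q then w i else 0) +
      if A.right i = q then w i else 0) = 0 := by
    intro q
    obtain ⟨q, rfl⟩ := (shear_bijective c).2 q
    refine Eq.trans (Finset.sum_congr rfl fun i _ => ?_) (hw q)
    simp only [(hA i).1, (hA i).2, hinj.eq_iff]
    rcases hdir i with ⟨h1, h2⟩ | ⟨h1, h2⟩
    · rw [h1, h2]
    · rw [h1, h2, add_comm]
  refine ⟨A.potential w, fun g q => ?_⟩
  refine Eq.trans (Finset.sum_congr rfl fun i _ => ?_)
    (A.sum_jump_eq_zero hM w hw' g (shear c q))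
  simp only [(hA i).1, (hA i).2, hinj.eq_iff]
  rcases hdir i with ⟨h1, h2⟩ | ⟨h1, h2⟩
  · rw [h1, h2]
  · rw [h1, h2, add_comm]

/-! ### Polygonal paths -/

/-- The points `p 0, …, p n` are the consecutive corners of a simple polygonal path. -/
structure IsSimplePolygonalPath (n : ℕ) (p : ℕ → ℝ × ℝ) : Prop where
  pos : 0 < n
  ne : ∀ i < n, p i ≠ p (i + 1)
  inter : ∀ i, i + 1 < n →
    segment ℝ (p i) (p (i + 1)) ∩ segment ℝ (p (i + 1)) (p (i + 2)) = {p (i + 1)}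
  disjoint : ∀ i j, i + 1 < j → j < n →
    Disjoint (segment ℝ (p i) (p (i + 1))) (segment ℝ (p j) (p (j + 1)))

namespace IsSimplePolygonalPath

variable {n : ℕ} {p : ℕ → ℝ × ℝ}

theorem eq_of_mem_of_mem (h : IsSimplePolygonalPath n p) {i j : ℕ} (hij : i < j) (hj : j < n)
    {z : ℝ × ℝ} (hzi : z ∈ segment ℝ (p i) (p (i + 1))) (hzj : z ∈ segment ℝ (p j) (p (j + 1))) :
    j = i + 1 ∧ z = p j := by
  rcases (Nat.succ_le_of_lt hij).lt_or_eq with h1 | rfl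
  · exact absurd hzj (Set.disjoint_left.1 (h.disjoint i j h1 hj) hzi)
  · exact ⟨rfl, by simpa using (h.inter i hj).subset ⟨hzi, hzj⟩⟩

theorem injOn (h : IsSimplePolygonalPath n p) {i j : ℕ} (hi : i ≤ n) (hj : j ≤ n)
    (hij : p i = p j) : i = j := by
  have key : ∀ i j, i < j → j ≤ n → p i ≠ p j := by
    intro i j hij hj h'
    obtain ⟨j, rfl⟩ : ∃ k, j = k + 1 := ⟨j - 1, by omega⟩
    rcases (Nat.le_of_lt_succ hij).lt_or_eq with h1 | rfl
    · have := h.eq_of_mem_of_mem h1 (by omega) (left_mem_segment ℝ _ _)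
        (h' ▸ right_mem_segment ℝ _ _)
      obtain ⟨rfl, h2⟩ := this
      exact h.ne i (by omega) h2
    · exact h.ne i (by omega) h'
  rcases lt_trichotomy i j with h1 | h1 | h1
  · exact absurd hij (key i j h1 hj)
  · exact h1
  · exact absurd hij.symm (key j i h1 hi)

theorem eq_end_of_mem (h : IsSimplePolygonalPath n p) {i j : ℕ} (hi : i < n) (hj : j < n)
    (hij : i ≠ j) {z : ℝ × ℝ} (hzi : z ∈ segment ℝ (p i) (p (i + 1)))
    (hzj : z ∈ segment ℝ (p j) (p (j + 1))) : z = p i ∨ z = p (i + 1) := by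
  rcases hij.lt_or_gt with h1 | h1
  · obtain ⟨rfl, h2⟩ := h.eq_of_mem_of_mem h1 hj hzi hzj
    exact Or.inr h2
  · exact Or.inl (h.eq_of_mem_of_mem h1 hi hzj hzi).2

theorem eq_end_of_first_mem (h : IsSimplePolygonalPath n p) {i : ℕ} (hi : i < n)
    (h0 : p 0 ∈ segment ℝ (p i) (p (i + 1))) : p 0 = p i ∨ p 0 = p (i + 1) := by
  by_cases hi0 : i = 0
  · exact Or.inl (by rw [hi0])
  · exact h.eq_end_of_mem hi h.pos hi0 h0 (left_mem_segment ℝ _ _)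

theorem eq_end_of_last_mem (h : IsSimplePolygonalPath n p) {i : ℕ} (hi : i < n)
    (h0 : p n ∈ segment ℝ (p i) (p (i + 1))) : p n = p i ∨ p n = p (i + 1) := by
  have hpos := h.pos
  by_cases hi0 : i = n - 1
  · exact Or.inr (by rw [hi0, Nat.sub_add_cancel h.pos])
  · refine h.eq_end_of_mem hi (by omega : n - 1 < n) hi0 h0 ?_
    rw [Nat.sub_add_cancel hpos]
    exact right_mem_segment ℝ _ _

end IsSimplePolygonalPath

/-- Every inner corner of a path is counted twice and cancels. -/
theorem sum_range_add_succ {N : Type*} [AddCommGroup N] (hN : ∀ m : N, m + m = 0) (f : ℕ → N)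
    {n : ℕ} (hn : 0 < n) : ∑ i : Fin n, (f i + f (i + 1)) = f 0 + f n := by
  rw [Fin.sum_univ_eq_sum_range (fun i => f i + f (i + 1))]
  induction n, hn using Nat.le_induction with
  | base => simp
  | succ n _ ih =>
    rw [Finset.sum_range_succ, ih, add_assoc, ← add_assoc (f n), hN, zero_add]

theorem ite_add_ite_of_not_and {N : Type*} [AddCommGroup N] {a b : Prop} [Decidable a]
    [Decidable b] (h : ¬ (a ∧ b)) (k : N) :
    ((if a then k else 0) + if b then k else 0) = if a ∨ b then k else 0 := by
  by_cases ha : a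
  · simp [ha, show ¬ b from fun hb => h ⟨ha, hb⟩]
  · simp [ha]

/-! ### Potentials of plane drawings -/

open Classical in
/-- If the weights of the edges of a plane graph sum up to zero at every vertex, then there is a
potential (assigning a value to one side of each edge, the value at the other side differing by the
weight) such that the jumps of any function of the potential sum up to zero at every vertex. -/
theorem PlaneDrawing.exists_potential {V M : Type*} {G : SimpleGraph V} [Fintype G.edgeSet]
    [AddCommGroup M] (D : PlaneDrawing G) (hM : ∀ m : M, m + m = 0) (w : G.edgeSet → M)
    (hw : ∀ v : V, ∑ e : G.edgeSet, (if v ∈ (e : Sym2 V) then w e else 0) = 0) :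
    ∃ U : G.edgeSet → M, ∀ (g : M → ZMod 2) (v : V),
      ∑ e : G.edgeSet, (if v ∈ (e : Sym2 V) then g (U e) + g (U e + w e) else 0) = 0 := by
  have hpath : ∀ e : G.edgeSet, ∃ (u v : V) (n : ℕ) (p : ℕ → ℝ × ℝ), (e : Sym2 V) = s(u, v) ∧
      p 0 = D.point u ∧ p n = D.point v ∧ IsSimplePolygonalPath n p ∧
      ∀ z, z ∈ D.arc e ↔ ∃ i < n, z ∈ segment ℝ (p i) (p (i + 1)) := by
    rintro ⟨e, he⟩
    induction e with
    | h u v =>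
    obtain ⟨n, p, h1, h2, h3, h4, h5, h6, h7⟩ := D.arc_isPolygonalArc u v he
    exact ⟨u, v, n, p, rfl, h2, h3, ⟨h1, h4, h5, h6⟩, fun z => by simp [h7]⟩
  choose a b n p hab hp0 hpn hp harc using hpath
  let ι := Σ e : G.edgeSet, Fin (n e)
  let P : ι → ℝ × ℝ := fun x => p x.1 x.2
  let Q : ι → ℝ × ℝ := fun x => p x.1 (x.2 + 1)
  have hends : ∀ e f : G.edgeSet, e ≠ f → ∀ z ∈ D.arc e, z ∈ D.arc f →
      z = p e 0 ∨ z = p e (n e) := by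
    intro e f hef z hze hzf
    obtain ⟨x, hx, _, rfl⟩ := D.eq_point_of_mem_arc e f hef z ⟨hze, hzf⟩
    rw [hab, Sym2.mem_iff] at hx
    rcases hx with rfl | rfl
    · exact Or.inl (hp0 e).symm
    · exact Or.inr (hpn e).symm
  have hcross : ∀ i j : ι, i ≠ j → ∀ z ∈ segment ℝ (P i) (Q i), z ∈ segment ℝ (P j) (Q j) →
      z = P i ∨ z = Q i := by
    rintro ⟨e, i⟩ ⟨f, j⟩ hij z hzi hzj
    by_cases hef : e = f
    · subst hef
      exact (hp e).eq_end_of_mem i.2 j.2 (fun h => hij (by rw [Fin.ext h])) hzi hzj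
    · rcases hends e f hef z ((harc e z).2 ⟨i, i.2, hzi⟩) ((harc f z).2 ⟨j, j.2, hzj⟩) with rfl | rfl
      · exact (hp e).eq_end_of_first_mem i.2 hzi
      · exact (hp e).eq_end_of_last_mem i.2 hzi
  have hincident : ∀ (e : G.edgeSet) (v : V), v ∈ (e : Sym2 V) ↔
      (p e 0 = D.point v ∨ p e (n e) = D.point v) := by
    intro e v
    rw [hp0, hpn, hab, Sym2.mem_iff, D.point_injective.eq_iff, D.point_injective.eq_iff,
      eq_comm, eq_comm (a := v)]
  have hnot : ∀ (e : G.edgeSet) q, ¬ (p e 0 = q ∧ p e (n e) = q) := by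
    rintro e q ⟨h1, h2⟩
    have := (hp e).injOn (Nat.zero_le _) le_rfl (h1.trans h2.symm)
    exact (hp e).pos.ne this
  have hwP : ∀ q, ∑ x : ι, ((if P x = q then w x.1 else 0) + if Q x = q then w x.1 else 0) = 0 := by
    intro q
    rw [Fintype.sum_sigma]
    have h1 : ∀ e : G.edgeSet, ∑ i : Fin (n e), ((if P ⟨e, i⟩ = q then w e else 0) +
        if Q ⟨e, i⟩ = q then w e else 0) =
        (if p e 0 = q then w e else 0) + if p e (n e) = q then w e else 0 := fun e =>
      sum_range_add_succ hM (fun i => if p e i = q then w e else 0) (hp e).pos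
    refine (Finset.sum_congr rfl fun e _ => h1 e).trans ?_
    by_cases hq : ∃ v, D.point v = q
    · obtain ⟨v, rfl⟩ := hq
      refine Eq.trans (Finset.sum_congr rfl fun e _ => ?_) (hw v)
      have := hnot e (D.point v)
      simp only [hincident]
      exact ite_add_ite_of_not_and this _
    · refine Finset.sum_eq_zero fun e _ => ?_
      rw [if_neg fun h => hq ⟨_, (hp0 e).symm.trans h⟩,
        if_neg fun h => hq ⟨_, (hpn e).symm.trans h⟩, add_zero]
  obtain ⟨U, hU⟩ := exists_potential_of_segments P Q (fun x => (hp x.1).ne _ x.2.2) hcross hM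
    (fun x => w x.1) hwP
  -- At an inner corner of an arc only two segments end, both from that arc, so their jumps agree.
  -- The jump is therefore constant along the arc, and the first segment can represent the edge.
  have hbend : ∀ (g : M → ZMod 2) (e : G.edgeSet) (i : ℕ) (hi : i < n e),
      g (U ⟨e, ⟨i, hi⟩⟩) + g (U ⟨e, ⟨i, hi⟩⟩ + w e) =
        g (U ⟨e, ⟨0, (hp e).pos⟩⟩) + g (U ⟨e, ⟨0, (hp e).pos⟩⟩ + w e) := by
    intro g e i
    induction i with
    | zero => exact fun _ => rfl
    | succ i ih =>
      intro hi
      rw [← ih (by omega)]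
      have hsame : ∀ (f : G.edgeSet) (j : ℕ), j ≤ n f → p f j = p e (i + 1) → f = e ∧ j = i + 1 := by
        intro f j hj h
        by_cases hfe : e = f
        · subst hfe
          exact ⟨rfl, (hp e).injOn hj hi.le h⟩
        · exfalso
          have h1 : p e (i + 1) ∈ D.arc e := (harc e _).2 ⟨i + 1, hi, left_mem_segment ℝ _ _⟩
          have h2 : p e (i + 1) ∈ D.arc f := by
            rw [← h, harc]
            rcases hj.lt_or_eq with hj | rfl
            · exact ⟨j, hj, left_mem_segment ℝ _ _⟩
            · refine ⟨n f - 1, Nat.sub_lt (hp f).pos one_pos, ?_⟩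
              rw [Nat.sub_add_cancel (show 1 ≤ n f from (hp f).pos)]
              exact right_mem_segment ℝ _ _
          rcases hends e f hfe _ h1 h2 with h3 | h3
          · have := (hp e).injOn hi.le (Nat.zero_le _) h3
            omega
          · have := (hp e).injOn hi.le le_rfl h3
            omega
      have hP : ∀ x : ι, P x = p e (i + 1) ↔ x = ⟨e, ⟨i + 1, hi⟩⟩ := by
        rintro ⟨f, j⟩
        refine ⟨fun h => ?_, fun h => by rw [h]⟩
        obtain ⟨rfl, h2⟩ := hsame f j j.2.le h
        congr 1
        exact Fin.ext h2
      have hQ : ∀ x : ι, Q x = p e (i + 1) ↔ x = ⟨e, ⟨i, by omega⟩⟩ := by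
        rintro ⟨f, j⟩
        refine ⟨fun h => ?_, fun h => by rw [h]⟩
        obtain ⟨rfl, h2⟩ := hsame f (j + 1) j.2 h
        congr 1
        exact Fin.ext (Nat.succ_injective h2)
      have := hU g (p e (i + 1))
      simp only [hP, hQ] at this
      rw [Finset.sum_add_distrib, Finset.sum_ite_eq', Finset.sum_ite_eq',
        if_pos (Finset.mem_univ _), if_pos (Finset.mem_univ _)] at this
      exact CharTwo.add_eq_zero.1 this
  refine ⟨fun e => U ⟨e, ⟨0, (hp e).pos⟩⟩, fun g v => ?_⟩
  refine Eq.trans (Finset.sum_congr rfl fun e _ => ?_)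
    ((Fintype.sum_sigma _).symm.trans (hU g (D.point v)))
  set k := g (U ⟨e, ⟨0, (hp e).pos⟩⟩) + g (U ⟨e, ⟨0, (hp e).pos⟩⟩ + w e) with hk
  have h1 := sum_range_add_succ CharTwo.add_self_eq_zero
    (fun i => if p e i = D.point v then k else 0) (hp e).pos
  have h2 := hnot e (D.point v)
  refine Eq.trans (Eq.trans ?_ h1.symm) (Finset.sum_congr rfl fun i _ => ?_)
  · simp only [hincident]
    exact (ite_add_ite_of_not_and h2 _).symm
  · rw [hk, ← hbend g e i i.2]

/-! ### Cycle spaces and sparsity -/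

theorem pi_zmod_two_add_self {ι : Type*} (f : ι → ZMod 2) : f + f = 0 :=
  funext fun i => CharTwo.add_self_eq_zero (f i)

namespace GraphicMatroid

variable {V : Type*} {G : SimpleGraph V}

open Classical in
/-- The boundary map over the field with two elements of the spanning subgraph with edges `S`. -/
noncomputable def boundary (S : Finset G.edgeSet) : (S → ZMod 2) →ₗ[ZMod 2] (V → ZMod 2) where
  toFun Z v := ∑ e : S, if v ∈ ((e : G.edgeSet) : Sym2 V) then Z e else 0
  map_add' Z Z' := by
    ext v
    simp only [Pi.add_apply, ← Finset.sum_add_distrib]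
    exact Finset.sum_congr rfl fun e _ => by split_ifs <;> simp
  map_smul' a Z := by
    ext v
    simp only [Pi.smul_apply, smul_eq_mul, Finset.mul_sum, RingHom.id_apply]
    exact Finset.sum_congr rfl fun e _ => by split_ifs <;> simp

open Classical in
theorem mem_ker_boundary {S : Finset G.edgeSet} {Z : S → ZMod 2} :
    Z ∈ LinearMap.ker (boundary S) ↔
      ∀ v : V, ∑ e : S, (if v ∈ ((e : G.edgeSet) : Sym2 V) then Z e else 0) = 0 := by
  rw [LinearMap.mem_ker, funext_iff]
  rfl

/-- Parity: a single edge at `v` would give a nonzero boundary there. -/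
theorem exists_ne_of_mem_ker_boundary {S : Finset G.edgeSet} {Z : S → ZMod 2}
    (hZ : Z ∈ LinearMap.ker (boundary S)) {e : S} (he : Z e ≠ 0) {v : V}
    (hv : v ∈ ((e : G.edgeSet) : Sym2 V)) :
    ∃ f : S, f ≠ e ∧ Z f ≠ 0 ∧ v ∈ ((f : G.edgeSet) : Sym2 V) := by
  by_contra! h
  have := mem_ker_boundary.1 hZ v
  rw [Finset.sum_eq_single e, if_pos hv] at this
  · exact he this
  · intro f _ hfe
    by_cases hf : Z f = 0
    · simp [hf]
    · rw [if_neg (h f hfe hf)]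
  · simp

/-- In a simple graph, every nonzero element of the cycle space has at least three edges. -/
theorem three_le_card_of_mem_ker_boundary {S : Finset G.edgeSet} {Z : S → ZMod 2}
    (hZ : Z ∈ LinearMap.ker (boundary S)) (hZ0 : Z ≠ 0) :
    3 ≤ (Finset.univ.filter fun e => Z e ≠ 0).card := by
  obtain ⟨e, he⟩ := Function.ne_iff.1 hZ0
  obtain ⟨u, v, huv⟩ : ∃ u v, ((e : G.edgeSet) : Sym2 V) = s(u, v) :=
    Sym2.ind (f := fun x => ∃ u v, x = s(u, v)) (fun u v => ⟨u, v, rfl⟩) _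
  have hne : u ≠ v := by
    have := (e : G.edgeSet).2
    rw [huv] at this
    exact G.ne_of_adj this
  obtain ⟨f, hfe, hf, huf⟩ := exists_ne_of_mem_ker_boundary hZ he (v := u) (by simp [huv])
  obtain ⟨h, hhe, hh, hvh⟩ := exists_ne_of_mem_ker_boundary hZ he (v := v) (by simp [huv])
  refine Finset.two_lt_card.2 ⟨e, by simpa using he, f, by simpa using hf, h, by simpa using hh,
    hfe.symm, hhe.symm, ?_⟩
  -- If the further edges at `u` and at `v` coincided, they would be parallel to `e`.
  rintro rfl
  have := (Sym2.mem_and_mem_iff hne).1 ⟨huf, hvh⟩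
  exact hfe (Subtype.ext (Subtype.ext (this.trans huv.symm)))

/-! ### The rank of the boundary map -/

open Classical in
theorem single_add_single_mem_span {B : Set G.edgeSet} {x y : V}
    (h : (spanningSubgraph G B).Reachable x y) :
    (Pi.single x 1 + Pi.single y 1 : V → ZMod 2) ∈ Submodule.span (ZMod 2)
      ((fun e : G.edgeSet => fun v => if v ∈ (e : Sym2 V) then (1 : ZMod 2) else 0) '' B) := by
  obtain ⟨p⟩ := h
  induction p with
  | nil =>
    rw [pi_zmod_two_add_self]
    exact Submodule.zero_mem _
  | @cons x z y hxz _ ih =>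
    have hne := hxz.ne
    have hm : s(x, z) ∈ (spanningSubgraph G B).edgeSet := hxz
    rw [edgeSet_spanningSubgraph] at hm
    obtain ⟨b, hb, hbe⟩ := hm
    have h1 : (Pi.single x 1 + Pi.single z 1 : V → ZMod 2) =
        fun v => if v ∈ (b : Sym2 V) then (1 : ZMod 2) else 0 := by
      ext v
      rw [hbe]
      by_cases h1 : v = x
      · subst h1
        simp [hne]
      · by_cases h2 : v = z
        · subst h2
          simp [h1]
        · simp [h1, h2]
    have h2 : (Pi.single x 1 + Pi.single y 1 : V → ZMod 2) =
        (Pi.single x 1 + Pi.single z 1) + (Pi.single z 1 + Pi.single y 1) := by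
      rw [add_assoc, ← add_assoc (Pi.single z 1 : V → ZMod 2), pi_zmod_two_add_self, zero_add]
    rw [h2]
    refine Submodule.add_mem _ (Submodule.subset_span ⟨b, hb, h1.symm⟩) ih

/-- Otherwise adding `e` to `B` would close no cycle, against the maximality of `B` in `S`. -/
theorem reachable_of_isBasis [Finite V] {B S : Set G.edgeSet}
    (hB : (graphicMatroid G).IsBasis B S) {e : G.edgeSet} (he : e ∈ S) {x y : V}
    (hxy : (e : Sym2 V) = s(x, y)) : (spanningSubgraph G B).Reachable x y := by
  by_contra hnr
  have hne : x ≠ y := fun h => hnr (h ▸ SimpleGraph.Reachable.refl x)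
  have hacyc : (spanningSubgraph G B).IsAcyclic := hB.indep
  have hins : (graphicMatroid G).Indep (insert e B) := by
    change (spanningSubgraph G (insert e B)).IsAcyclic
    convert hacyc.sup_edge_of_not_reachable hnr using 1
    rw [← SimpleGraph.edgeSet_inj, edgeSet_spanningSubgraph, SimpleGraph.edgeSet_sup,
      edgeSet_edge_of_ne hne, edgeSet_spanningSubgraph, Set.image_insert_eq, hxy,
      Set.union_singleton]
  refine hnr (SimpleGraph.Adj.reachable ?_)
  rw [← SimpleGraph.mem_edgeSet, edgeSet_spanningSubgraph]
  exact ⟨e, hB.mem_of_insert_indep he hins, hxy⟩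

-- The boundary of an edge of `S` is the sum of the boundaries along a path in a basis of `S`, since
-- inner vertices cancel. So the boundaries of the basis edges span the range.
open Classical in
theorem finrank_range_boundary_le [Finite V] (S : Finset G.edgeSet) :
    Module.finrank (ZMod 2) (LinearMap.range (boundary S)) ≤
      ((graphicMatroid G).eRk (S : Set G.edgeSet)).toNat := by
  obtain ⟨B, hB⟩ := (graphicMatroid G).exists_isBasis (S : Set G.edgeSet) (Set.subset_univ _)
  have hfin : B.Finite := S.finite_toSet.subset hB.subset
  obtain ⟨B, rfl⟩ := hfin.exists_finset_coe
  rw [← hB.encard_eq_eRk, Set.encard_coe_eq_coe_finsetCard, ENat.toNat_natCast]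
  let bd : G.edgeSet → V → ZMod 2 := fun e v => if v ∈ (e : Sym2 V) then (1 : ZMod 2) else 0
  have hle : LinearMap.range (boundary S) ≤
      Submodule.span (ZMod 2) ((B.image bd : Finset (V → ZMod 2)) : Set (V → ZMod 2)) := by
    rintro _ ⟨Z, rfl⟩
    have h1 : boundary S Z = ∑ e : S, Z e • bd e := by
      ext v
      simp [boundary, bd]
    rw [h1]
    refine Submodule.sum_mem _ fun e _ => Submodule.smul_mem _ _ ?_
    obtain ⟨x, y, hxy⟩ : ∃ x y, ((e : G.edgeSet) : Sym2 V) = s(x, y) :=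
      Sym2.ind (f := fun x => ∃ u v, x = s(u, v)) (fun u v => ⟨u, v, rfl⟩) _
    have hne : x ≠ y := by
      have := (e : G.edgeSet).2
      rw [hxy] at this
      exact G.ne_of_adj this
    have h2 : bd e = Pi.single x 1 + Pi.single y 1 := by
      ext v
      simp only [bd, hxy]
      by_cases h1 : v = x
      · subst h1
        simp [hne]
      · by_cases h2 : v = y
        · subst h2
          simp [h1]
        · simp [h1, h2]
    rw [h2, Finset.coe_image]
    exact single_add_single_mem_span (reachable_of_isBasis hB e.2 hxy)
  exact (Submodule.finrank_mono hle).trans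
    ((finrank_span_finset_le_card _).trans Finset.card_image_le)

/-! ### The dimension of the cycle space of a plane graph -/

open Classical in
theorem sum_edgeSet_eq {M : Type*} [AddCommMonoid M] [Fintype G.edgeSet] {S : Finset G.edgeSet}
    (f : G.edgeSet → M) (hf : ∀ e ∉ S, f e = 0) (v : V) :
    ∑ e : G.edgeSet, (if v ∈ (e : Sym2 V) then f e else 0) =
      ∑ e : S, if v ∈ ((e : G.edgeSet) : Sym2 V) then f e else 0 := by
  rw [Finset.sum_coe_sort S fun e : G.edgeSet => if v ∈ (e : Sym2 V) then f e else 0]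
  exact (Finset.sum_subset (Finset.subset_univ _) fun e _ he => by rw [hf e he, ite_self]).symm

open Classical in
/-- The cycle space of a plane graph is spanned by a family of elements such that every edge
lies in at most two of them; hence its dimension is at most two thirds of the number of edges. -/
theorem three_mul_finrank_ker_boundary_le [Fintype G.edgeSet] (D : PlaneDrawing G)
    (S : Finset G.edgeSet) :
    3 * Module.finrank (ZMod 2) (LinearMap.ker (boundary S)) ≤ 2 * S.card := by
  set C := LinearMap.ker (boundary S) with hC
  let _ : Fintype C := Fintype.ofFinite C
  -- A universal weight: one potential serves all cycle-space elements at once. Edges outside `S`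
  -- get weight 0 because the drawing is of all of `G`.
  let w : G.edgeSet → C → ZMod 2 := fun e => if h : e ∈ S then fun Z => Z.1 ⟨e, h⟩ else 0
  have hw0 : ∀ e ∉ S, w e = 0 := fun e he => dif_neg he
  have hwS : ∀ (e : S) (Z : C), w e Z = Z.1 e := fun e Z => by simp [w]
  obtain ⟨U, hU⟩ := D.exists_potential (M := C → ZMod 2) pi_zmod_two_add_self w (by
    intro v
    rw [sum_edgeSet_eq w hw0]
    ext Z
    rw [Finset.sum_apply]
    refine Eq.trans ?_ (mem_ker_boundary.1 Z.2 v)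
    exact Finset.sum_congr rfl fun e _ => by split_ifs <;> simp [hwS])
  -- The boundary of the region labelled `m`: the jumps of the indicator function of `m`.
  let c : (C → ZMod 2) → C := fun m => ⟨fun e => (if U e = m then 1 else 0) +
      if U e + w e = m then 1 else 0, mem_ker_boundary.2 fun v => by
    rw [← sum_edgeSet_eq (fun e => (if U e = m then 1 else 0) + if U e + w e = m then 1 else 0)]
    · exact hU (fun x => if x = m then 1 else 0) v
    · intro e he
      rw [hw0 e he, add_zero, CharTwo.add_self_eq_zero]⟩
  have hc : ∀ m e, (c m).1 e = (if U e = m then 1 else 0) + if U e + w e = m then 1 else 0 :=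
    fun _ _ => rfl
  let T : Finset (C → ZMod 2) := Finset.univ.filter fun m => c m ≠ 0
  have hspan : (⊤ : Submodule (ZMod 2) C) ≤
      Submodule.span (ZMod 2) ((T.image c : Finset C) : Set C) := by
    intro Z _
    -- Evaluation at `Z` is a combination of indicators of labels, and its jump across `e` is `w e Z
    -- = Z e`.
    have hZ : Z = ∑ m : C → ZMod 2, m Z • c m := by
      ext e
      simp only [Submodule.coe_sum, Submodule.coe_smul, Finset.sum_apply, Pi.smul_apply, hc,
        smul_eq_mul, mul_add, mul_ite, mul_one, mul_zero, Finset.sum_add_distrib,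
        Finset.sum_ite_eq, Finset.mem_univ, if_true, Pi.add_apply, hwS]
      rw [← add_assoc, CharTwo.add_self_eq_zero, zero_add]
    rw [hZ]
    refine Submodule.sum_mem _ fun m _ => Submodule.smul_mem _ _ ?_
    by_cases hm : c m = 0
    · rw [hm]
      exact Submodule.zero_mem _
    · exact Submodule.subset_span (by
        rw [Finset.coe_image]
        exact ⟨m, by simpa [T] using hm, rfl⟩)
  have hdim : Module.finrank (ZMod 2) C ≤ T.card := by
    rw [← finrank_top (ZMod 2) C]
    exact (Submodule.finrank_mono hspan).trans
      ((finrank_span_finset_le_card _).trans Finset.card_image_le)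
  have hcount : 3 * T.card ≤ 2 * S.card := by
    calc 3 * T.card = ∑ m ∈ T, 3 := by rw [Finset.sum_const, smul_eq_mul, mul_comm]
      _ ≤ ∑ m ∈ T, (Finset.univ.filter fun e => (c m).1 e ≠ 0).card := by
        refine Finset.sum_le_sum fun m hm => three_le_card_of_mem_ker_boundary (c m).2 fun h => ?_
        exact (Finset.mem_filter.1 hm).2 (Subtype.ext h)
      _ = ∑ e : S, (T.filter fun m => (c m).1 e ≠ 0).card := by
        simp only [Finset.card_filter]
        exact Finset.sum_comm
      _ ≤ ∑ e : S, 2 := by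
        refine Finset.sum_le_sum fun e _ => ?_
        refine (Finset.card_le_card (t := {U e, U e + w e}) fun m hm => ?_).trans
          Finset.card_le_two
        have h := (Finset.mem_filter.1 hm).2
        rw [Finset.mem_insert, Finset.mem_singleton]
        by_contra! hne
        rw [hc, if_neg hne.1.symm, if_neg hne.2.symm, add_zero] at h
        exact h rfl
      _ = 2 * S.card := by simp [mul_comm]
  omega

/-- Rank-nullity for the boundary map, with nullity at most 2|S|/3 and rank at most r(S). -/
theorem card_le_three_mul_eRk [Finite V] (hG : IsPlanar G) (S : Finset G.edgeSet) :
    S.card ≤ 3 * ((graphicMatroid G).eRk (S : Set G.edgeSet)).toNat := by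
  have _ : Fintype G.edgeSet := Fintype.ofFinite _
  obtain ⟨D⟩ := hG
  have h1 := three_mul_finrank_ker_boundary_le D S
  have h2 := finrank_range_boundary_le S
  have h3 := LinearMap.finrank_range_add_finrank_ker (boundary S)
  rw [Module.finrank_fintype_fun_eq_card, Fintype.card_coe] at h3
  omega

/-- The graphic matroid of a planar graph is `3`-sparse. -/
theorem isSparse_of_isPlanar [Finite V] (hG : IsPlanar G) : IsSparse 3 (graphicMatroid G) := by
  intro S _
  exact_mod_cast card_le_three_mul_eRk hG S

end GraphicMatroid

/-! ### Greedy independent sets and fixed-set mechanisms -/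

section Mechanism

variable {E : Type*}

open Classical in
/-- A greedy independent set in a sparse matroid has at least a `1 / k` fraction of the
total weight; the term with `c` keeps account of the elements by which it exceeds this bound. -/
theorem exists_indep_weight_aux {M : Matroid E} (hE : M.E = Set.univ) {k : ℕ}
    (hM : ∀ S : Finset E, S.card ≤ k * (M.eRk (S : Set E)).toNat) (w : E → ℝ≥0∞) (S : Finset E) :
    ∃ I : Finset E, M.IsBasis (I : Set E) (S : Set E) ∧ ∀ c : ℝ≥0∞, (∀ i ∈ S, c ≤ w i) →
      ∑ i ∈ S, w i + ((k * I.card - S.card : ℕ) : ℝ≥0∞) * c ≤ k * ∑ i ∈ I, w i := by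
  have hcard : ∀ I S : Finset E, M.IsBasis (I : Set E) (S : Set E) → S.card ≤ k * I.card := by
    intro I S h
    have := hM S
    rwa [← h.encard_eq_eRk, Set.encard_coe_eq_coe_finsetCard, ENat.toNat_natCast] at this
  -- One unit of surplus pays for a new element of weight `b`; the remaining units are devalued from
  -- `b` to `c`.
  have hinc : ∀ (x y : ℝ≥0∞) (c b : ℝ≥0∞) (n : ℕ), c ≤ b → x + (n + 1 : ℕ) * b ≤ y →
      b + x + (n : ℕ) * c ≤ y := by
    intro x y c b n hcb h
    refine le_trans ?_ h
    push_cast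
    rw [add_mul, one_mul, add_comm b x, add_assoc, add_comm _ b]
    gcongr
  -- Elements enter by decreasing weight, as in the greedy algorithm. Sparsity (`hcard`) keeps the
  -- surplus `k * I.card - S.card` from being truncated.
  induction S using Finset.induction_on_min_value w with
  | empty =>
    refine ⟨∅, ?_, ?_⟩
    · simp
    · simp
  | insert a S ha hmin ih =>
    obtain ⟨I, hI, hw⟩ := ih
    have haI : a ∉ I := fun h => ha (hI.subset h)
    have hSI := hcard I S hI
    have h0 := hw (w a) hmin
    by_cases hins : M.Indep (insert a (I : Set E))
    · have hI' : M.IsBasis ((insert a I : Finset E) : Set E) ((insert a S : Finset E) : Set E) := by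
        rw [Finset.coe_insert, Finset.coe_insert]
        exact hI.insert_isBasis_insert hins
      refine ⟨insert a I, hI', fun c hc => ?_⟩
      have hca : c ≤ w a := hc a (Finset.mem_insert_self _ _)
      have hcard' := hcard _ _ hI'
      rw [Finset.sum_insert ha, Finset.sum_insert haI, Finset.card_insert_of_notMem ha,
        Finset.card_insert_of_notMem haI]
      rw [Finset.card_insert_of_notMem ha, Finset.card_insert_of_notMem haI] at hcard'
      refine hinc _ _ c (w a) _ hca ?_
      have e : k * (I.card + 1) - (S.card + 1) + 1 = (k * I.card - S.card) + k := by
        rw [mul_add, mul_one] at hcard' ⊢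
        omega
      rw [e, mul_add, add_comm ((k : ℝ≥0∞) * w a)]
      push_cast [Nat.cast_sub hSI] at h0 ⊢
      rw [add_mul, ← add_assoc]
      gcongr
    · have hI' : M.IsBasis (I : Set E) ((insert a S : Finset E) : Set E) := by
        refine hI.indep.isBasis_of_forall_insert ?_ ?_
        · exact hI.subset.trans (by simp)
        · rintro e ⟨he, heI⟩
          rw [Matroid.dep_iff]
          refine ⟨?_, by rw [hE]; exact Set.subset_univ _⟩
          rw [Finset.coe_insert] at he
          rcases he with rfl | he
          · exact hins
          · exact fun h => heI (hI.mem_of_insert_indep he h)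
      refine ⟨I, hI', fun c hc => ?_⟩
      have hca : c ≤ w a := hc a (Finset.mem_insert_self _ _)
      have hcard' := hcard _ _ hI'
      rw [Finset.sum_insert ha, Finset.card_insert_of_notMem ha]
      rw [Finset.card_insert_of_notMem ha] at hcard'
      refine hinc _ _ c (w a) _ hca ?_
      have e : k * I.card - (S.card + 1) + 1 = k * I.card - S.card := by omega
      rw [e]
      exact h0

theorem exists_indep_sum_le [Fintype E] {M : Matroid E} (hE : M.E = Set.univ) {k : ℕ}
    (hM : ∀ S : Finset E, S.card ≤ k * (M.eRk (S : Set E)).toNat) (w : E → ℝ≥0∞) :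
    ∃ I : Finset E, M.Indep (I : Set E) ∧ ∑ i, w i ≤ k * ∑ i ∈ I, w i := by
  obtain ⟨I, hI, h⟩ := exists_indep_weight_aux hE hM w Finset.univ
  exact ⟨I, hI.indep, by simpa using h 0 fun _ _ => zero_le⟩

open Classical in
/-- The thresholds by which exactly the items of `I` may be accepted, whatever their values are. -/
noncomputable def fixedSetThreshold (I : Finset E) : E → WithTop ℝ := fun i => if i ∈ I then 0 else ⊤

-- All accepted items lie in the independent set `I`, so the independence test never rejects an item
-- of `I`; the threshold 0 never does either, values being nonnegative.
open Classical in
theorem acceptedFrom_fixedSetThreshold {M : Matroid E} {I : Finset E} (hI : M.Indep (I : Set E))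
    (x : E → ℝ≥0) (l : List E) (S : Finset E) (hS : S ⊆ I) :
    acceptedFrom M (fixedSetThreshold I) x l S = S ∪ I.filter (· ∈ l) := by
  induction l generalizing S with
  | nil => simp [acceptedFrom]
  | cons i l ih =>
    rw [acceptedFrom]
    by_cases hi : i ∈ I
    · have hins : insert i S ⊆ I := Finset.insert_subset hi hS
      have hT : fixedSetThreshold I i ≤ ((x i : ℝ) : WithTop ℝ) := by
        rw [fixedSetThreshold, if_pos hi]
        exact_mod_cast (x i).2
      have hS' : M.Indep (insert i (S : Set E)) := hI.subset (by exact_mod_cast hins)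
      rw [if_pos ⟨hT, hS'⟩, ih _ hins]
      ext j
      simp only [Finset.mem_union, Finset.mem_insert, Finset.mem_filter, List.mem_cons]
      constructor
      · rintro ((rfl | h) | ⟨h1, h2⟩)
        exacts [Or.inr ⟨hi, Or.inl rfl⟩, Or.inl h, Or.inr ⟨h1, Or.inr h2⟩]
      · rintro (h | ⟨h1, rfl | h2⟩)
        exacts [Or.inl (Or.inr h), Or.inl (Or.inl rfl), Or.inr ⟨h1, h2⟩]
    · rw [if_neg, ih _ hS]
      · ext j
        simp only [Finset.mem_union, Finset.mem_filter, List.mem_cons]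
        refine or_congr_right (and_congr_right fun hj => ?_)
        exact ⟨Or.inr, Or.rec (fun h => absurd (h ▸ hj) hi) id⟩
      · rintro ⟨h, _⟩
        rw [fixedSetThreshold, if_neg hi, top_le_iff] at h
        exact WithTop.coe_ne_top h

theorem gamblerValue_fixedSetThreshold {M : Matroid E} {I : Finset E} (hI : M.Indep (I : Set E))
    (x : E → ℝ≥0) {l : List E} (hl : ∀ i, i ∈ l) :
    gamblerValue M (fixedSetThreshold I) l x = ∑ i ∈ I, x i := by
  classical
  rw [gamblerValue, acceptedFrom_fixedSetThreshold hI x l ∅ (Finset.empty_subset _)]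
  simp [hl]

/-! ### Expected values of the prophet and of fixed-set mechanisms -/

variable [Fintype E]

/-- This crude bound suffices, since in a sparse matroid one independent set carries a fixed
fraction of the whole sum. -/
theorem prophetValue_le_sum (M : Matroid E) (x : E → ℝ≥0) : prophetValue M x ≤ ∑ i, x i :=
  Finset.sup_le fun _ _ => Finset.sum_le_sum_of_subset (Finset.subset_univ _)

theorem lintegral_sum_valueLaw (D : E → ProbabilityMeasure ℝ≥0) (I : Finset E) :
    ∫⁻ x, ((∑ i ∈ I, x i : ℝ≥0) : ℝ≥0∞) ∂(valueLaw D) =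
      ∑ i ∈ I, ∫⁻ y, (y : ℝ≥0∞) ∂(D i : Measure ℝ≥0) := by
  simp only [ENNReal.ofNNReal_finsetSum]
  rw [lintegral_finsetSum _ fun i _ => by fun_prop]
  refine Finset.sum_congr rfl fun i _ => ?_
  exact (measurePreserving_eval (fun i => (D i : Measure ℝ≥0)) i).lintegral_comp
    measurable_coe_nnreal_ennreal

/-- The mechanism that, given the distributions, offers to accept all items of the set `I D` and
no other items. -/
noncomputable def fixedSetMechanism (I : (E → ProbabilityMeasure ℝ≥0) → Finset E) :
    NonAdaptiveMechanism E where
  thresholdLaw D := ⟨Measure.dirac (fixedSetThreshold (I D)), Measure.dirac.isProbabilityMeasure⟩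

theorem expectedGambler_fixedSetMechanism {M : Matroid E}
    {I : (E → ProbabilityMeasure ℝ≥0) → Finset E} (D : E → ProbabilityMeasure ℝ≥0)
    (hI : M.Indep (I D : Set E)) {l : List E} (hl : ∀ i, i ∈ l) :
    expectedGambler M (fixedSetMechanism I) D l =
      ∑ i ∈ I D, ∫⁻ y, (y : ℝ≥0∞) ∂(D i : Measure ℝ≥0) := by
  change ∫⁻ T, _ ∂(Measure.dirac (fixedSetThreshold (I D))) = _
  rw [lintegral_dirac]
  simp only [gamblerValue_fixedSetThreshold hI _ hl]
  exact lintegral_sum_valueLaw D (I D)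

/-- A `k`-sparse matroid all of whose elements are items has a `k`-competitive non-adaptive
mechanism. -/
theorem exists_isCompetitive_of_sparse {M : Matroid E} (hE : M.E = Set.univ) {k : ℕ} (hk : 0 < k)
    (hM : ∀ S : Finset E, S.card ≤ k * (M.eRk (S : Set E)).toNat) :
    ∃ A : NonAdaptiveMechanism E, A.IsCompetitive k M := by
  -- The weights are the expected values, possibly infinite, hence the greedy bound in `ℝ≥0∞`.
  choose I hI hw using fun D : E → ProbabilityMeasure ℝ≥0 =>
    exists_indep_sum_le hE hM fun i => ∫⁻ y, (y : ℝ≥0∞) ∂(D i : Measure ℝ≥0)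
  refine ⟨fixedSetMechanism I, fun D l _ hl => ?_⟩
  rw [expectedGambler_fixedSetMechanism D (hI D) hl]
  have hprophet : expectedProphet M D ≤ ∑ i, ∫⁻ y, (y : ℝ≥0∞) ∂(D i : Measure ℝ≥0) := by
    rw [← lintegral_sum_valueLaw D Finset.univ]
    exact lintegral_mono fun x => ENNReal.coe_le_coe.2 (prophetValue_le_sum M x)
  have hk0 : (k : ℝ≥0∞) ≠ 0 := by exact_mod_cast hk.ne'
  rw [one_div, ENNReal.ofReal_inv_of_pos (by exact_mod_cast hk), ENNReal.ofReal_natCast]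
  calc (k : ℝ≥0∞)⁻¹ * expectedProphet M D
      ≤ (k : ℝ≥0∞)⁻¹ * (k * ∑ i ∈ I D, ∫⁻ y, (y : ℝ≥0∞) ∂(D i : Measure ℝ≥0)) := by
        gcongr
        exact hprophet.trans (hw D)
    _ = _ := by
        rw [← mul_assoc, ENNReal.inv_mul_cancel hk0 (ENNReal.natCast_ne_top k), one_mul]

end Mechanism

theorem mainTheorem11 {V : Type*} [Finite V] (G : SimpleGraph V) [Fintype G.edgeSet]
    (hG : IsPlanar G) :
    IsSparse 3 (graphicMatroid G) ∧
      ∃ A : NonAdaptiveMechanism G.edgeSet, A.IsCompetitive 3 (graphicMatroid G) := by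
  refine ⟨GraphicMatroid.isSparse_of_isPlanar hG, ?_⟩
  exact_mod_cast exists_isCompetitive_of_sparse (M := graphicMatroid G) rfl (k := 3) (by norm_num)
    (GraphicMatroid.card_le_three_mul_eRk hG)
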